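/- Let $M,N\in\mathbb Z\cup\{\infty\}$ be such that $E=\{i\in\mathbb Z:-M-1<i<N+1\}$ is non-empty, and let $a_i>0$ (death rates, $i\to i-1$) and $b_i>0$ (birth rates, $i\to i+1$), $i\in E$. For a reference point $o\in E$ put $$\mu_o=\frac1{a_ob_o},\qquad \mu_i=\frac{b_{o+1}\cdots b_{i-1}}{a_o\cdots a_i}\ (i\in E,\ i>o),\qquad \mu_i=\frac{a_{o-1}\cdots a_{i+1}}{b_o\cdots b_i}\ (i\in E,\ i<o)$$ (empty products are $1$). All functions $f$ on a subset of $\mathbb Z$ below are real, have finite support, and are extended by $0$ outside that subset; $\mu(f^2)=\sum_i\mu_if_i^2$. The Dirichlet eigenvalue of the birth–death process on $E$ is $$\lambda_0=\inf\Big\{\sum_{i\in E,\,i\le o}\mu_ia_i(f_i-f_{i-1})^2+\sum_{i\in E,\,i\ge o}\mu_ib_i(f_{i+1}-f_i)^2:\ f\text{ on }E,\ \mu(f^2)=1\Big\}$$ (so $-M-1$ is a Dirichlet boundary if $M<\infty$, and $N+1$ is one if $N<\infty$); it does not depend on $o$. For $\theta\in E$ and $\gamma>1$ let $\lambda_0^{\theta-,\gamma}$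 be the first eigenvalue of the process on $E^{\theta-}=\{i\in E:i\le\theta\}$ which reflects at $\theta$ and has the original rates except that $a_\theta$ is replaced by $\gamma a_\theta$, and let $\lambda_0^{\theta+,\gamma}$ be that of the process on $E^{\theta+}=\{i\in E:i\ge\theta\}$ which reflects at $\theta$ and has the original rates except that $b_\theta$ is replaced by $\frac{\gamma}{\gamma-1}b_\theta$. That is, $$\lambda_0^{\theta-,\gamma}=\inf\Big\{\sum_{i\in E^{\theta-}}\bar\mu_i\bar a_i(f_i-f_{i-1})^2:\ f\text{ on }E^{\theta-},\ \bar\mu(f^2)=1\Big\},\qquad \lambda_0^{\theta+,\gamma}=\inf\Big\{\sum_{i\in E^{\theta+}}\bar\mu_i\bar b_i(f_{i+1}-f_i)^2:\ f\text{ on }E^{\theta+},\ \bar\mu(f^2)=1\Big\},$$ where $\bar a,\bar b$ are the rates modified in the respective way and $\bar\mu$ is the measure $\mu$ formed with them and with $o=\theta$. At the ends: for $\theta=-M-1$ put $\lambda_0^{\theta-,\gamma}=\infty$ and let $\lambda_0^{\theta+,\gamma}$ be the first eigenvalue of the original process reflected at $-M$ if $M<\infty$ (and of the original process itself if $M=\infty$),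 i.e. $\inf\{\sum_{i\in E}\mu_ib_i(f_{i+1}-f_i)^2: f\text{ on }E,\ \mu(f^2)=1\}$; for $\theta=N+1$ put $\lambda_0^{\theta+,\gamma}=\infty$ and let $\lambda_0^{\theta-,\gamma}$ be the first eigenvalue of the original process reflected at $N$ if $N<\infty$ (and of the original process itself if $N=\infty$), i.e. $\inf\{\sum_{i\in E}\mu_ia_i(f_i-f_{i-1})^2: f\text{ on }E,\ \mu(f^2)=1\}$. **Theorem 7.10.** (1) One always has $$\inf_{\theta\in E}\,\inf_{\gamma>1}\big(\lambda_0^{\theta-,\gamma}\vee\lambda_0^{\theta+,\gamma}\big)=\lambda_0\ \ge\ \sup_{-M-1\le\theta\le N+1}\ \sup_{\gamma>1}\big(\lambda_0^{\theta-,\gamma}\wedge\lambda_0^{\theta+,\gamma}\big).$$ (2) Suppose that $\lambda_0^{\theta-,\gamma}>0$ for some $\theta\in E$, $\gamma>1$, that $\lambda_0^{\theta+,\gamma}>0$ for some $\theta\in E$, $\gamma>1$ (neither positivity depends on the choice of $\theta$ and $\gamma$), and that $$\sum_{i\in E,\,i\le o}\mu_i=\infty\ \text{ if }M=\infty,\qquad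 \sum_{i\in E,\,i\ge o}\mu_i=\infty\ \text{ if }N=\infty.$$ Then $$\lambda_0=\sup_{\theta\in E}\ \sup_{\gamma>1}\big(\lambda_0^{\theta-,\gamma}\wedge\lambda_0^{\theta+,\gamma}\big).$$ -/

import Mathlib

open scoped BigOperators

namespace BirthDeath

/-- The state space `E = {i ∈ ℤ : -M-1 < i < N+1}`, i.e. `-M ≤ i ≤ N`, where each of `M`, `N` is an
integer or `∞`. -/
def stateSpace (M N : WithTop ℤ) : Set ℤ :=
  {i : ℤ | ((-i : ℤ) : WithTop ℤ) ≤ M ∧ (i : WithTop ℤ) ≤ N}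

/-- The symmetrizing measure of the birth rates `b` and death rates `a`, relative to the reference
point `o`:  `μ_o = 1 / (a_o b_o)`,
`μ_i = (b_{o+1} ⋯ b_{i-1}) / (a_o ⋯ a_i)` for `i > o`,
`μ_i = (a_{o-1} ⋯ a_{i+1}) / (b_o ⋯ b_i)` for `i < o`. -/
noncomputable def symmMeasure (a b : ℤ → ℝ) (o i : ℤ) : ℝ :=
  if o < i then (∏ j ∈ Finset.Ioo o i, b j) / ∏ j ∈ Finset.Icc o i, a j
  else if i < o then (∏ j ∈ Finset.Ioo i o, a j) / ∏ j ∈ Finset.Icc i o, b j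
  else 1 / (a o * b o)

/-- `∑_{i ∈ S} μ_i a_i (f_i - f_{i-1})²` (a finite sum for the finitely supported `f` below). -/
noncomputable def leftEnergy (S : Set ℤ) (μ a f : ℤ → ℝ) : ℝ :=
  ∑' i : S, μ i * a i * (f i - f ((i : ℤ) - 1)) ^ 2

/-- `∑_{i ∈ S} μ_i b_i (f_{i+1} - f_i)²` (a finite sum for the finitely supported `f` below). -/
noncomputable def rightEnergy (S : Set ℤ) (μ b f : ℤ → ℝ) : ℝ :=
  ∑' i : S, μ i * b i * (f ((i : ℤ) + 1) - f i) ^ 2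

/-- The Dirichlet form `D` of the process on `E` with Dirichlet boundaries at the finite ones of
`-M-1` and `N+1`. -/
noncomputable def dirichletForm (M N : WithTop ℤ) (a b : ℤ → ℝ) (o : ℤ) (f : ℤ → ℝ) : ℝ :=
  leftEnergy (stateSpace M N ∩ Set.Iic o) (symmMeasure a b o) a f +
    rightEnergy (stateSpace M N ∩ Set.Ici o) (symmMeasure a b o) b f

/-- The normalized finitely supported functions on `S`, extended by zero outside `S`. -/
def testFunctions (S : Set ℤ) (μ : ℤ → ℝ) : Set (ℤ → ℝ) :=
  {f | f.support.Finite ∧ f.support ⊆ S ∧ ∑' i : ℤ, μ i * f i ^ 2 = 1}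

/-- `inf {D(f) : μ(f²) = 1, f finitely supported on S}`. -/
noncomputable def firstEigenvalue (S : Set ℤ) (μ : ℤ → ℝ) (D : (ℤ → ℝ) → ℝ) : EReal :=
  ⨅ f ∈ testFunctions S μ, ((D f : ℝ) : EReal)

/-- The Dirichlet eigenvalue `λ₀` of the process on `E`. -/
noncomputable def lam0 (M N : WithTop ℤ) (a b : ℤ → ℝ) (o : ℤ) : EReal :=
  firstEigenvalue (stateSpace M N) (symmMeasure a b o) (dirichletForm M N a b o)

/-- `λ₀^{θ-,γ}` for `θ ∈ E`: the first eigenvalue of the process on `{i ∈ E : i ≤ θ}`, reflecting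
at `θ`, with `a_θ` replaced by `γ a_θ`. -/
noncomputable def lamMinus (M N : WithTop ℤ) (a b : ℤ → ℝ) (θ : ℤ) (γ : ℝ) : EReal :=
  firstEigenvalue (stateSpace M N ∩ Set.Iic θ)
    (symmMeasure (Function.update a θ (γ * a θ)) b θ)
    (leftEnergy (stateSpace M N ∩ Set.Iic θ)
      (symmMeasure (Function.update a θ (γ * a θ)) b θ) (Function.update a θ (γ * a θ)))

/-- `λ₀^{θ+,γ}` for `θ ∈ E`: the first eigenvalue of the process on `{i ∈ E : θ ≤ i}`, reflecting
at `θ`, with `b_θ` replaced by `γ (γ-1)⁻¹ b_θ`. -/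
noncomputable def lamPlus (M N : WithTop ℤ) (a b : ℤ → ℝ) (θ : ℤ) (γ : ℝ) : EReal :=
  firstEigenvalue (stateSpace M N ∩ Set.Ici θ)
    (symmMeasure a (Function.update b θ (γ * (γ - 1)⁻¹ * b θ)) θ)
    (rightEnergy (stateSpace M N ∩ Set.Ici θ)
      (symmMeasure a (Function.update b θ (γ * (γ - 1)⁻¹ * b θ)) θ)
      (Function.update b θ (γ * (γ - 1)⁻¹ * b θ)))

/-- The first eigenvalue of the process on `E` which, if `M < ∞`, is reflected at `-M` (there is no
jump from `-M` to `-M-1`). If `M = ∞` this is the process on `E` itself. -/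
noncomputable def lamReflectLeft (M N : WithTop ℤ) (a b : ℤ → ℝ) (o : ℤ) : EReal :=
  firstEigenvalue (stateSpace M N) (symmMeasure a b o)
    (rightEnergy (stateSpace M N) (symmMeasure a b o) b)

/-- The first eigenvalue of the process on `E` which, if `N < ∞`, is reflected at `N` (there is no
jump from `N` to `N+1`). If `N = ∞` this is the process on `E` itself. -/
noncomputable def lamReflectRight (M N : WithTop ℤ) (a b : ℤ → ℝ) (o : ℤ) : EReal :=
  firstEigenvalue (stateSpace M N) (symmMeasure a b o)
    (leftEnergy (stateSpace M N) (symmMeasure a b o) a)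

/-- The range `-M-1 ≤ θ ≤ N+1` of splitting points: the points of `E` and the two ends. -/
inductive SplitPoint (M N : WithTop ℤ) : Type
  /-- `θ = -M-1` -/
  | leftEnd : SplitPoint M N
  /-- `θ ∈ E` -/
  | interior (θ : ℤ) (hθ : θ ∈ stateSpace M N) : SplitPoint M N
  /-- `θ = N+1` -/
  | rightEnd : SplitPoint M N

/-- `λ₀^{θ-,γ}` for `-M-1 ≤ θ ≤ N+1`. -/
noncomputable def lamMinusExt (M N : WithTop ℤ) (a b : ℤ → ℝ) (o : ℤ) (γ : ℝ) :
    SplitPoint M N → EReal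
  | .leftEnd => ⊤
  | .interior θ _ => lamMinus M N a b θ γ
  | .rightEnd => lamReflectRight M N a b o

/-- `λ₀^{θ+,γ}` for `-M-1 ≤ θ ≤ N+1`. -/
noncomputable def lamPlusExt (M N : WithTop ℤ) (a b : ℤ → ℝ) (o : ℤ) (γ : ℝ) :
    SplitPoint M N → EReal
  | .leftEnd => lamReflectLeft M N a b o
  | .interior θ _ => lamPlus M N a b θ γ
  | .rightEnd => ⊤

end BirthDeath

namespace BirthDeath

/-! Cut the line at `θ`, giving a fraction `t = 1/γ` of the mass at `θ` to the left half and `1 - t`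
to the right. With reference point `θ`, the modified rates produce exactly these masses and leave
all conductances unchanged, so mass and energy are sums of their two halves. A real `r` lies below
an eigenvalue iff the matching `Poincare` inequality holds, and everything is proved for these
inequalities.

Adding the halves (`Poincare.of_split`) bounds the minimum by `λ₀`. Conversely, violators of the two
halves can be scaled to agree at `θ` and glued into a violator on `E` (`Poincare.left_or_right`), so
`λ₀` is at most the maximum. That the infimum of the maxima is attained in the limit is an
intermediate value argument (`exists_split`): moving the cut `(θ, t)` along a test function of
quotient below `R` shares the strict deficit between both halves.

For the second part (`exists_splitting`), take the last `θ` whose left inequality holds with no mass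
at `θ`; infinite mass at the infinite ends, tested with indicators of intervals, makes such `θ`
exist and stay bounded. At this `θ` the left inequality holds for some `t > 0` and the right one for
some `t < 1`. The sets of good `t` are closed and cover the line, so by connectedness one `t` serves
both sides (`exists_common`). -/

/-- The weighted square sum `∑ w_i f_i²`. -/
noncomputable def mass (w f : ℤ → ℝ) : ℝ := ∑' i, w i * f i ^ 2

/-- The energy `∑ k_i (f_{i+1} - f_i)²` of the conductances `k_i` on the edges `{i, i+1}`. -/
noncomputable def energy (k f : ℤ → ℝ) : ℝ := ∑' i, k i * (f (i + 1) - f i) ^ 2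

/-- The measure `μ` restricted to `{i ≤ θ}`, with the fraction `t` of the mass at `θ`. -/
noncomputable def leftMass (μ : ℤ → ℝ) (θ : ℤ) (t : ℝ) (i : ℤ) : ℝ :=
  if i < θ then μ i else if i = θ then t * μ θ else 0

/-- The measure `μ` restricted to `{θ ≤ i}`, with the fraction `1 - t` of the mass at `θ`. -/
noncomputable def rightMass (μ : ℤ → ℝ) (θ : ℤ) (t : ℝ) (i : ℤ) : ℝ :=
  if θ < i then μ i else if i = θ then (1 - t) * μ θ else 0

/-- The conductances of the edges to the left of `θ`. -/
noncomputable def leftCond (K : ℤ → ℝ) (θ i : ℤ) : ℝ := if i < θ then K i else 0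

/-- The conductances of the edges to the right of `θ`. -/
noncomputable def rightCond (K : ℤ → ℝ) (θ i : ℤ) : ℝ := if θ ≤ i then K i else 0

/-- `f` has finite support, contained in `E`. -/
def FinSupp (E : Set ℤ) (f : ℤ → ℝ) : Prop := f.support.Finite ∧ f.support ⊆ E

/-- The Poincaré inequality `r ∑ w_i f_i² ≤ ∑ k_i (f_{i+1} - f_i)²` for finitely supported `f`. -/
def Poincare (E : Set ℤ) (w k : ℤ → ℝ) (r : ℝ) : Prop :=
  ∀ f, FinSupp E f → r * mass w f ≤ energy k f

/-! ### Calculus of masses and energies -/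

section basic

variable {E : Set ℤ} {f g : ℤ → ℝ}

lemma FinSupp.eq_zero (hf : FinSupp E f) {i : ℤ} (hi : i ∉ E) : f i = 0 := by
  by_contra h
  exact hi (hf.2 h)

lemma FinSupp.smul (hf : FinSupp E f) (c : ℝ) : FinSupp E (fun i => c * f i) := by
  have : Function.support (fun i => c * f i) ⊆ f.support := by
    intro i hi h
    exact hi (by simp [h])
  exact ⟨hf.1.subset this, this.trans hf.2⟩

lemma summable_mass (hf : f.support.Finite) (w : ℤ → ℝ) : Summable fun i => w i * f i ^ 2 := by
  refine summable_of_hasFiniteSupport (hf.subset ?_)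
  intro i hi h
  exact hi (by simp [h])

lemma summable_energy (hf : f.support.Finite) (k : ℤ → ℝ) :
    Summable fun i => k i * (f (i + 1) - f i) ^ 2 := by
  refine summable_of_hasFiniteSupport
    ((hf.union (hf.preimage ((add_left_injective (1 : ℤ)).injOn))).subset ?_)
  intro i hi
  by_contra h
  simp only [Set.mem_union, Function.mem_support, Set.mem_preimage, not_or, not_not] at h
  exact hi (by simp [h.1, h.2])

lemma mass_add (hf : f.support.Finite) (v w : ℤ → ℝ) :
    mass (fun i => v i + w i) f = mass v f + mass w f := by
  simp only [mass, add_mul]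
  exact (summable_mass hf v).tsum_add (summable_mass hf w)

lemma energy_add (hf : f.support.Finite) (k l : ℤ → ℝ) :
    energy (fun i => k i + l i) f = energy k f + energy l f := by
  simp only [energy, add_mul]
  exact (summable_energy hf k).tsum_add (summable_energy hf l)

lemma mass_const_mul (c : ℝ) (w f : ℤ → ℝ) : mass (fun i => c * w i) f = c * mass w f := by
  simp only [mass, mul_assoc, tsum_mul_left]

lemma mass_smul (w f : ℤ → ℝ) (c : ℝ) : mass w (fun i => c * f i) = c ^ 2 * mass w f := by
  simp only [mass, ← tsum_mul_left]
  exact tsum_congr fun i => by ring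

lemma energy_smul (k f : ℤ → ℝ) (c : ℝ) : energy k (fun i => c * f i) = c ^ 2 * energy k f := by
  simp only [energy, ← tsum_mul_left]
  exact tsum_congr fun i => by ring

lemma mass_nonneg {w : ℤ → ℝ} (hw : ∀ i, 0 ≤ w i) (f : ℤ → ℝ) : 0 ≤ mass w f :=
  tsum_nonneg fun i => mul_nonneg (hw i) (sq_nonneg _)

lemma energy_nonneg {k : ℤ → ℝ} (hk : ∀ i, 0 ≤ k i) (f : ℤ → ℝ) : 0 ≤ energy k f :=
  tsum_nonneg fun i => mul_nonneg (hk i) (sq_nonneg _)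

lemma energy_mono (hf : f.support.Finite) {k l : ℤ → ℝ} (h : ∀ i, k i ≤ l i) :
    energy k f ≤ energy l f :=
  (summable_energy hf k).tsum_le_tsum
    (fun i => mul_le_mul_of_nonneg_right (h i) (sq_nonneg _)) (summable_energy hf l)

lemma mass_mono (hf : f.support.Finite) {v w : ℤ → ℝ} (h : ∀ i, v i ≤ w i) :
    mass v f ≤ mass w f :=
  (summable_mass hf v).tsum_le_tsum
    (fun i => mul_le_mul_of_nonneg_right (h i) (sq_nonneg _)) (summable_mass hf w)

lemma term_le_mass (hf : f.support.Finite) {w : ℤ → ℝ} (hw : ∀ i, 0 ≤ w i) (i : ℤ) :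
    w i * f i ^ 2 ≤ mass w f :=
  (summable_mass hf w).le_tsum i fun j _ => mul_nonneg (hw j) (sq_nonneg _)

lemma term_le_energy (hf : f.support.Finite) {k : ℤ → ℝ} (hk : ∀ i, 0 ≤ k i) (i : ℤ) :
    k i * (f (i + 1) - f i) ^ 2 ≤ energy k f :=
  (summable_energy hf k).le_tsum i fun j _ => mul_nonneg (hk j) (sq_nonneg _)

lemma mass_congr {v w : ℤ → ℝ} (h : ∀ i, v i * f i ^ 2 = w i * g i ^ 2) : mass v f = mass w g :=
  tsum_congr h

lemma energy_congr {k l : ℤ → ℝ}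
    (h : ∀ i, k i * (f (i + 1) - f i) ^ 2 = l i * (g (i + 1) - g i) ^ 2) :
    energy k f = energy l g :=
  tsum_congr h

end basic

/-! ### Cutting the line at a point -/

section split

variable {E : Set ℤ} {μ K f : ℤ → ℝ} {θ : ℤ} {t : ℝ}

lemma leftMass_nonneg (hμ : ∀ i, 0 ≤ μ i) (ht : 0 ≤ t) (i : ℤ) : 0 ≤ leftMass μ θ t i := by
  unfold leftMass
  have := mul_nonneg ht (hμ θ)
  split_ifs <;> first | exact hμ i | exact this | exact le_rfl

lemma rightMass_nonneg (hμ : ∀ i, 0 ≤ μ i) (ht : t ≤ 1) (i : ℤ) : 0 ≤ rightMass μ θ t i := by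
  unfold rightMass
  have := mul_nonneg (sub_nonneg.2 ht) (hμ θ)
  split_ifs <;> first | exact hμ i | exact this | exact le_rfl

lemma leftCond_nonneg (hK : ∀ i, 0 ≤ K i) (i : ℤ) : 0 ≤ leftCond K θ i := by
  unfold leftCond
  split_ifs <;> first | exact hK i | exact le_rfl

lemma rightCond_nonneg (hK : ∀ i, 0 ≤ K i) (i : ℤ) : 0 ≤ rightCond K θ i := by
  unfold rightCond
  split_ifs <;> first | exact hK i | exact le_rfl

lemma mass_left_add_right (hf : f.support.Finite) (μ : ℤ → ℝ) (θ : ℤ) (t : ℝ) :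
    mass (leftMass μ θ t) f + mass (rightMass μ θ t) f = mass μ f := by
  rw [← mass_add hf]
  refine mass_congr fun i => ?_
  unfold leftMass rightMass
  rcases lt_trichotomy i θ with h | h | h
  · simp [h, h.not_gt, h.ne]
  · subst h; simp only [lt_irrefl, if_false, if_true]; ring
  · simp [h, h.not_gt, h.ne']

lemma energy_left_add_right (hf : f.support.Finite) (K : ℤ → ℝ) (θ : ℤ) :
    energy (leftCond K θ) f + energy (rightCond K θ) f = energy K f := by
  rw [← energy_add hf]
  refine energy_congr fun i => ?_
  unfold leftCond rightCond
  rcases lt_or_ge i θ with h | h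
  · simp [h, h.not_ge]
  · simp [h, h.not_gt]

lemma mass_point (θ : ℤ) (s : ℝ) (f : ℤ → ℝ) :
    mass (fun i => if i = θ then s else 0) f = s * f θ ^ 2 := by
  unfold mass
  rw [tsum_eq_single θ (by intro i hi; simp [hi])]
  simp

/-- For fixed `f` the left mass is affine in `t`; this gives the choice of `t` in `exists_split` and
the closedness in `isClosed_poincare_left`. -/
lemma mass_leftMass (hf : f.support.Finite) (μ : ℤ → ℝ) (θ : ℤ) (t : ℝ) :
    mass (leftMass μ θ t) f = mass (leftMass μ θ 0) f + t * (μ θ * f θ ^ 2) := by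
  rw [← mul_assoc, ← mass_point θ (t * μ θ) f, ← mass_add hf]
  refine mass_congr fun i => ?_
  unfold leftMass
  rcases lt_trichotomy i θ with h | h | h
  · simp [h, h.ne]
  · subst h; simp
  · simp [h.not_gt, h.ne']

lemma mass_rightMass (hf : f.support.Finite) (μ : ℤ → ℝ) (θ : ℤ) (t : ℝ) :
    mass (rightMass μ θ t) f = mass (rightMass μ θ 1) f + (1 - t) * (μ θ * f θ ^ 2) := by
  rw [← mul_assoc, ← mass_point θ ((1 - t) * μ θ) f, ← mass_add hf]
  refine mass_congr fun i => ?_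
  unfold rightMass
  rcases lt_trichotomy i θ with h | h | h
  · simp [h.not_gt, h.ne]
  · subst h; simp
  · simp [h, h.ne']

lemma Poincare.of_split {r : ℝ} (hl : Poincare E (leftMass μ θ t) (leftCond K θ) r)
    (hr : Poincare E (rightMass μ θ t) (rightCond K θ) r) : Poincare E μ K r := by
  intro f hf
  rw [← mass_left_add_right hf.1 μ θ t, ← energy_left_add_right hf.1 K θ, mul_add]
  exact add_le_add (hl f hf) (hr f hf)

/-- Two functions violating the one-sided inequalities can be glued at `θ`. -/
lemma Poincare.left_or_right {r : ℝ} (h : Poincare E μ K r) (θ : ℤ) (t : ℝ) :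
    Poincare E (leftMass μ θ t) (leftCond K θ) r ∨
      Poincare E (rightMass μ θ t) (rightCond K θ) r := by
  by_contra hcon
  simp only [Poincare, not_or, not_forall, not_le] at hcon
  obtain ⟨⟨f, hf, hlt⟩, g, hg, hgt⟩ := hcon
  -- The scaled functions must agree at `θ`. One coefficient may vanish, but the strict violation on
  -- the other side survives.
  obtain ⟨α, β, hαβ, hne⟩ : ∃ α β : ℝ, α * f θ = β * g θ ∧ (α ≠ 0 ∨ β ≠ 0) := by
    by_cases h0 : f θ = 0
    · exact ⟨1, 0, by simp [h0], Or.inl one_ne_zero⟩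
    · exact ⟨g θ, f θ, mul_comm _ _, Or.inr h0⟩
  let q : ℤ → ℝ := fun i => if i ≤ θ then α * f i else β * g i
  have hql : ∀ i, i ≤ θ → q i = α * f i := fun i hi => if_pos hi
  have hqr : ∀ i, θ ≤ i → q i = β * g i := by
    intro i hi
    rcases hi.eq_or_lt with rfl | hi
    · exact (hql _ le_rfl).trans hαβ
    · exact if_neg hi.not_ge
  have hqs : q.support ⊆ f.support ∪ g.support := by
    intro i hi
    by_contra hc
    simp only [Set.mem_union, Function.mem_support, not_or, not_not] at hc
    refine hi ?_
    simp [q, hc.1, hc.2]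
  have hq : FinSupp E q :=
    ⟨(hf.1.union hg.1).subset hqs, hqs.trans (Set.union_subset hf.2 hg.2)⟩
  have e1 : energy (leftCond K θ) q = α ^ 2 * energy (leftCond K θ) f := by
    rw [← energy_smul]
    refine energy_congr fun i => ?_
    by_cases hi : i < θ
    · rw [hql i hi.le, hql (i + 1) (by omega)]
    · simp [leftCond, hi]
  have e2 : energy (rightCond K θ) q = β ^ 2 * energy (rightCond K θ) g := by
    rw [← energy_smul]
    refine energy_congr fun i => ?_
    by_cases hi : θ ≤ i
    · rw [hqr i hi, hqr (i + 1) (by omega)]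
    · simp [rightCond, hi]
  have m1 : mass (leftMass μ θ t) q = α ^ 2 * mass (leftMass μ θ t) f := by
    rw [← mass_smul]
    refine mass_congr fun i => ?_
    by_cases hi : i ≤ θ
    · rw [hql i hi]
    · simp [leftMass, show ¬ i < θ by omega, show i ≠ θ by omega]
  have m2 : mass (rightMass μ θ t) q = β ^ 2 * mass (rightMass μ θ t) g := by
    rw [← mass_smul]
    refine mass_congr fun i => ?_
    by_cases hi : θ ≤ i
    · rw [hqr i hi]
    · simp [rightMass, show ¬ θ < i by omega, show i ≠ θ by omega]
  have key := h q hq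
  rw [← mass_left_add_right hq.1 μ θ t, ← energy_left_add_right hq.1 K θ, e1, e2, m1, m2] at key
  rcases hne with h0 | h0
  · have := mul_lt_mul_of_pos_left hlt (sq_pos_of_ne_zero h0)
    have := mul_le_mul_of_nonneg_left hgt.le (sq_nonneg β)
    linarith
  · have := mul_le_mul_of_nonneg_left hlt.le (sq_nonneg α)
    have := mul_lt_mul_of_pos_left hgt (sq_pos_of_ne_zero h0)
    linarith

/-- The cuts `(θ, 1)` and `(θ + 1, 0)` carry the same mass, so the cut moves continuously in mass
from one site to the next. -/
lemma leftMass_succ_zero (μ : ℤ → ℝ) (θ : ℤ) : leftMass μ (θ + 1) 0 = leftMass μ θ 1 := by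
  funext i
  unfold leftMass
  rcases lt_trichotomy i θ with h | h | h
  · simp [h, show i < θ + 1 by omega]
  · subst h; simp
  · simp [h.not_gt, h.ne', show ¬ i < θ + 1 by omega]

lemma leftCond_le_succ (hK : ∀ i, 0 ≤ K i) (θ i : ℤ) : leftCond K θ i ≤ leftCond K (θ + 1) i := by
  unfold leftCond
  have := hK i
  split_ifs <;> first | exact le_rfl | assumption | omega

lemma Poincare.left_succ {r : ℝ} (hK : ∀ i, 0 ≤ K i)
    (h : Poincare E (leftMass μ θ 1) (leftCond K θ) r) :
    Poincare E (leftMass μ (θ + 1) 0) (leftCond K (θ + 1)) r := by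
  intro f hf
  rw [leftMass_succ_zero]
  exact (h f hf).trans (energy_mono hf.1 (leftCond_le_succ hK θ))

/-- A function with Rayleigh quotient less than `R` splits at some point into two parts with
Rayleigh quotients at most `R`. -/
lemma exists_split (hμ : ∀ i, 0 ≤ μ i) (hK : ∀ i, 0 ≤ K i) {R : ℝ}
    (hf : FinSupp E f) (hR : energy K f < R * mass μ f) :
    ∃ θ ∈ E, ∃ t : ℝ, 0 < t ∧ t < 1 ∧
      energy (leftCond K θ) f ≤ R * mass (leftMass μ θ t) f ∧ 0 < mass (leftMass μ θ t) f ∧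
      energy (rightCond K θ) f ≤ R * mass (rightMass μ θ t) f ∧
      0 < mass (rightMass μ θ t) f := by
  have hmass := mass_nonneg hμ f
  have hen := energy_nonneg hK f
  have hRpos : 0 < R := by
    by_contra h
    nlinarith [mul_nonneg (neg_nonneg.2 (not_lt.1 h)) hmass]
  -- The excess of the left half: nonnegative left of the support, negative at its upper bound `u`.
  -- The cut is made at the first `θ` where it is negative.
  set h : ℤ → ℝ := fun θ => energy (leftCond K θ) f - R * mass (leftMass μ θ 1) f with hh
  obtain ⟨u, hu⟩ := hf.1.bddAbove
  obtain ⟨l, hl⟩ := hf.1.bddBelow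
  have hu0 : ∀ i, u < i → f i = 0 := fun i hi => by
    by_contra hne
    exact absurd (hu hne) hi.not_ge
  have hl0 : ∀ i, i < l → f i = 0 := fun i hi => by
    by_contra hne
    exact absurd (hl hne) hi.not_ge
  have hhu : h u < 0 := by
    have e1 : energy (leftCond K u) f ≤ energy K f := by
      rw [← energy_left_add_right hf.1 K u]
      exact le_add_of_nonneg_right (energy_nonneg (rightCond_nonneg hK) f)
    have e2 : mass (leftMass μ u 1) f = mass μ f := by
      refine mass_congr fun i => ?_
      unfold leftMass
      rcases lt_trichotomy i u with h | h | h
      · simp [h]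
      · subst h; simp
      · simp [hu0 i h]
    simp only [hh, e2]
    linarith
  have hlow : ∀ θ, h θ < 0 → l ≤ θ := by
    intro θ hθ
    by_contra hlt
    have e2 : mass (leftMass μ θ 1) f = mass (fun _ => 0) f := by
      refine mass_congr fun i => ?_
      unfold leftMass
      by_cases hi : i < l
      · simp [hl0 i hi]
      · simp [show ¬ i < θ by omega, show i ≠ θ by omega]
    have e3 : mass (fun _ => 0) f = 0 := by simp [mass]
    have := energy_nonneg (leftCond_nonneg (θ := θ) hK) f
    simp only [hh, e2, e3] at hθ
    linarith
  obtain ⟨θ, hθ, hmin⟩ := Int.exists_least_of_bdd ⟨l, hlow⟩ ⟨u, hhu⟩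
  have hprev : 0 ≤ energy (leftCond K θ) f - R * mass (leftMass μ θ 0) f := by
    have h1 : 0 ≤ h (θ - 1) := by
      by_contra hc
      have := hmin _ (not_le.1 hc)
      omega
    have e := leftMass_succ_zero μ (θ - 1)
    have e2 := energy_mono hf.1 (leftCond_le_succ hK (θ - 1))
    rw [sub_add_cancel] at e e2
    rw [e]
    simp only [hh] at h1
    linarith
  set m := μ θ * f θ ^ 2 with hm
  have hθ' : energy (leftCond K θ) f - R * mass (leftMass μ θ 0) f - R * m < 0 := by
    have := hθ
    simp only [hh, mass_leftMass hf.1 μ θ 1] at this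
    linarith
  have hRm : 0 < R * m := by linarith
  have hmpos : 0 < m := by
    by_contra hc
    nlinarith
  have hfθ : f θ ≠ 0 := by
    intro h0
    simp [hm, h0] at hmpos
  set x := energy (leftCond K θ) f - R * mass (leftMass μ θ 0) f with hx
  set T := energy K f - R * mass μ f with hT
  have hTneg : T < 0 := by linarith
  -- `y` is the prescribed left excess: `y < 0` serves the left half, `T < y` leaves `T - y < 0` for
  -- the right half, and `x - R * m < y < 0 ≤ x` puts `t = (x - y) / (R * m)` strictly between 0 and
  -- 1.
  obtain ⟨y, hy1, hy2⟩ := exists_between (max_lt hTneg hθ')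
  have hyT := (le_max_left _ _).trans_lt hy1
  have hyx := (le_max_right _ _).trans_lt hy1
  have ht0 : 0 < (x - y) / (R * m) := div_pos (by linarith) hRm
  have ht1 : (x - y) / (R * m) < 1 := by
    rw [div_lt_one hRm]
    linarith
  have htm : R * ((x - y) / (R * m) * m) = x - y := by
    have := hRpos.ne'
    have := hmpos.ne'
    field_simp
  generalize (x - y) / (R * m) = t at ht0 ht1 htm
  have m1 := mass_leftMass hf.1 μ θ t
  have m2 := mass_rightMass hf.1 μ θ t
  have s1 := mass_left_add_right hf.1 μ θ t
  have s2 := energy_left_add_right hf.1 K θ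
  rw [← hm] at m1 m2
  have hL : energy (leftCond K θ) f - R * mass (leftMass μ θ t) f = y := by
    rw [m1, mul_add, htm]
    linarith
  refine ⟨θ, hf.2 hfθ, t, ht0, ht1, by linarith, ?_, ?_, ?_⟩
  · have := mass_nonneg (leftMass_nonneg (θ := θ) hμ le_rfl) f
    have := mul_pos ht0 hmpos
    linarith
  · have : R * mass (rightMass μ θ t) f = R * mass μ f - R * mass (leftMass μ θ t) f := by
      rw [← s1]; ring
    linarith
  · have := mass_nonneg (rightMass_nonneg (θ := θ) hμ le_rfl) f
    have := mul_pos (sub_pos.2 ht1) hmpos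
    linarith

end split

/-! ### A cut at which both inequalities hold -/

section existence

variable {E : Set ℤ} {μ K : ℤ → ℝ} {θ o : ℤ} {r r' s t : ℝ}

lemma Poincare.mono_mass {v w k : ℤ → ℝ} (hr : 0 ≤ r) (hvw : ∀ i, v i ≤ w i)
    (h : Poincare E w k r) : Poincare E v k r := fun f hf =>
  (mul_le_mul_of_nonneg_left (mass_mono hf.1 hvw) hr).trans (h f hf)

lemma leftMass_mono (hμ : ∀ i, 0 ≤ μ i) (hst : s ≤ t) (i : ℤ) :
    leftMass μ θ s i ≤ leftMass μ θ t i := by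
  unfold leftMass
  have := mul_le_mul_of_nonneg_right hst (hμ θ)
  split_ifs <;> first | exact le_rfl | assumption

/-- Each test function imposes a closed condition on `t`, its mass being affine in `t`. -/
lemma isClosed_poincare_left : IsClosed {t | Poincare E (leftMass μ θ t) (leftCond K θ) r} := by
  simp only [Poincare, Set.ofPred_forall]
  refine isClosed_iInter fun f => isClosed_iInter fun hf => ?_
  have he : (fun t => mass (leftMass μ θ t) f) = _ := funext (mass_leftMass hf.1 μ θ)
  have hc : Continuous fun t => mass (leftMass μ θ t) f := by
    rw [he]
    fun_prop
  exact isClosed_le (hc.const_mul r) continuous_const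

lemma isClosed_poincare_right :
    IsClosed {t | Poincare E (rightMass μ θ t) (rightCond K θ) r} := by
  simp only [Poincare, Set.ofPred_forall]
  refine isClosed_iInter fun f => isClosed_iInter fun hf => ?_
  have he : (fun t => mass (rightMass μ θ t) f) = _ := funext (mass_rightMass hf.1 μ θ)
  have hc : Continuous fun t => mass (rightMass μ θ t) f := by
    rw [he]
    fun_prop
  exact isClosed_le (hc.const_mul r) continuous_const

/-- The value at `θ` is controlled by the energy to the left of `θ`. -/
lemma exists_value_bound (hμ : ∀ i, 0 ≤ μ i) (hμE : ∀ i ∈ E, 0 < μ i) (hK : ∀ i, 0 ≤ K i)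
    (hKE : ∀ i, i + 1 ∈ E → 0 < K i) (hθ : θ ∈ E) (hr : 0 < r)
    (h : Poincare E (leftMass μ θ 0) (leftCond K θ) r) :
    ∃ C, 0 < C ∧ ∀ f, FinSupp E f → f θ ^ 2 ≤ C * energy (leftCond K θ) f := by
  have hk : 0 < K (θ - 1) := hKE _ (by simpa using hθ)
  have hedge : ∀ f, FinSupp E f → (f θ - f (θ - 1)) ^ 2 ≤ energy (leftCond K θ) f / K (θ - 1) := by
    intro f hf
    have := term_le_energy hf.1 (leftCond_nonneg (θ := θ) hK) (θ - 1)
    rw [le_div_iff₀ hk]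
    simp only [leftCond, sub_add_cancel, sub_lt_self_iff, zero_lt_one, if_true] at this
    linarith
  -- The last edge controls `f θ - f (θ - 1)`. The value `f (θ - 1)` is controlled by the mass
  -- there, or is zero at a Dirichlet boundary.
  by_cases hp : θ - 1 ∈ E
  · have hm := hμE _ hp
    refine ⟨2 / K (θ - 1) + 2 / (r * μ (θ - 1)), by positivity, fun f hf => ?_⟩
    have h1 := hedge f hf
    have h2 : f (θ - 1) ^ 2 ≤ energy (leftCond K θ) f / (r * μ (θ - 1)) := by
      rw [le_div_iff₀ (mul_pos hr hm)]
      have h3 := term_le_mass hf.1 (leftMass_nonneg (θ := θ) hμ le_rfl) (θ - 1)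
      rw [show leftMass μ θ 0 (θ - 1) = μ (θ - 1) from if_pos (by omega)] at h3
      have h4 := mul_le_mul_of_nonneg_left h3 hr.le
      have h5 := h f hf
      linarith
    have h6 : f θ ^ 2 ≤ 2 * (f θ - f (θ - 1)) ^ 2 + 2 * f (θ - 1) ^ 2 := by
      nlinarith [sq_nonneg (f θ - 2 * f (θ - 1))]
    calc f θ ^ 2 ≤ 2 * (energy (leftCond K θ) f / K (θ - 1)) +
          2 * (energy (leftCond K θ) f / (r * μ (θ - 1))) := by linarith
      _ = _ := by ring
  · refine ⟨1 / K (θ - 1), by positivity, fun f hf => ?_⟩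
    have h1 := hedge f hf
    rw [hf.eq_zero hp, sub_zero] at h1
    rwa [one_div_mul_eq_div]

/-- A little of the mass at `θ` may be added at the cost of decreasing the constant. -/
lemma exists_left_pos (hμ : ∀ i, 0 ≤ μ i) (hμE : ∀ i ∈ E, 0 < μ i) (hK : ∀ i, 0 ≤ K i)
    (hKE : ∀ i, i + 1 ∈ E → 0 < K i) (hθ : θ ∈ E) (hr : 0 < r) (hrr : r < r')
    (h : Poincare E (leftMass μ θ 0) (leftCond K θ) r') :
    ∃ t, 0 < t ∧ t < 1 ∧ Poincare E (leftMass μ θ t) (leftCond K θ) r := by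
  have hr' := hr.trans hrr
  have hm := hμE θ hθ
  obtain ⟨C, hC, hbd⟩ := exists_value_bound hμ hμE hK hKE hθ hr' h
  -- The share `r / r'` of the energy pays for the mass left of `θ`; `δ` is what the remaining share
  -- can pay for at `θ`.
  set δ := (1 - r / r') / (r * μ θ * C) with hδ
  have hδpos : 0 < δ := by
    have : 0 < 1 - r / r' := sub_pos.2 ((div_lt_one hr').2 hrr)
    positivity
  refine ⟨min (1 / 2) δ, by positivity, (min_le_left _ _).trans_lt (by norm_num), fun f hf => ?_⟩
  rw [mass_leftMass hf.1]
  have hen := energy_nonneg (leftCond_nonneg (θ := θ) hK) f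
  have h1 : r * mass (leftMass μ θ 0) f ≤ r / r' * energy (leftCond K θ) f := by
    have := mul_le_mul_of_nonneg_left (h f hf) (div_pos hr hr').le
    rwa [← mul_assoc, div_mul_cancel₀ _ hr'.ne'] at this
  have h2 : r * (min (1 / 2) δ * (μ θ * f θ ^ 2)) ≤ (1 - r / r') * energy (leftCond K θ) f := by
    calc r * (min (1 / 2) δ * (μ θ * f θ ^ 2))
        ≤ r * (δ * (μ θ * (C * energy (leftCond K θ) f))) := by
          gcongr
          · exact min_le_right _ _
          · exact hbd f hf
      _ = _ := by
          rw [hδ]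
          field_simp
  linarith

/-- Only the site `θ` and its edge to the Dirichlet boundary remain on the right, so it suffices
that `r (1 - t) μ θ ≤ K θ`. -/
lemma exists_right_of_greatest (hμE : ∀ i ∈ E, 0 < μ i) (hK : ∀ i, 0 ≤ K i)
    (hKE : ∀ i ∈ E, 0 < K i) (hθ : IsGreatest E θ) (hr : 0 < r) :
    ∃ t, 0 < t ∧ t < 1 ∧ Poincare E (rightMass μ θ t) (rightCond K θ) r := by
  have hm := hμE θ hθ.1
  have hk := hKE θ hθ.1
  have hδ : 0 < K θ / (r * μ θ) := by positivity
  refine ⟨1 - min (1 / 2) (K θ / (r * μ θ)), ?_, ?_, fun f hf => ?_⟩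
  · have := min_le_left (1 / 2) (K θ / (r * μ θ))
    linarith
  · have : 0 < min (1 / 2) (K θ / (r * μ θ)) := by positivity
    linarith
  have hout : ∀ i, θ < i → f i = 0 := fun i hi => hf.eq_zero fun hE => (hθ.2 hE).not_gt hi
  have h0 : mass (rightMass μ θ 1) f = 0 := by
    have : mass (rightMass μ θ 1) f = mass (fun _ => 0) f := by
      refine mass_congr fun i => ?_
      unfold rightMass
      by_cases hi : θ < i
      · simp [hout i hi]
      · by_cases hi' : i = θ <;> simp [hi, hi']
    rw [this]
    simp [mass]
  rw [mass_rightMass hf.1, h0, zero_add, sub_sub_cancel]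
  have h1 := term_le_energy hf.1 (rightCond_nonneg (θ := θ) hK) θ
  rw [hout (θ + 1) (by omega)] at h1
  simp only [rightCond, le_refl, if_true, zero_sub, neg_sq] at h1
  refine le_trans ?_ h1
  calc r * (min (1 / 2) (K θ / (r * μ θ)) * (μ θ * f θ ^ 2))
      ≤ r * (K θ / (r * μ θ) * (μ θ * f θ ^ 2)) := by
        gcongr
        exact min_le_right _ _
    _ = K θ * f θ ^ 2 := by
        field_simp

lemma finSupp_indicator [E.OrdConnected] {l u : ℤ} (hl : l ∈ E) (hu : u ∈ E) :
    FinSupp E ((Set.Icc l u).indicator 1) :=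
  ⟨(Set.finite_Icc l u).subset Set.support_indicator_subset,
    Set.support_indicator_subset.trans (Set.Icc_subset E hl hu)⟩

/-- Testing the left inequality with the indicator of `[o, θ]`. -/
lemma Poincare.sum_le_left [E.OrdConnected] (ho : o ∈ E) (hθ : θ ∈ E) (hoθ : o ≤ θ)
    (h : Poincare E (leftMass μ θ 0) (leftCond K θ) r) :
    r * ∑ i ∈ Finset.Ico o θ, μ i ≤ leftCond K θ (o - 1) := by
  have hf := finSupp_indicator ho hθ
  have h1 := h _ hf
  have hm : mass (leftMass μ θ 0) ((Set.Icc o θ).indicator 1) = ∑ i ∈ Finset.Ico o θ, μ i := by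
    unfold mass
    rw [tsum_eq_sum (s := Finset.Ico o θ)]
    · refine Finset.sum_congr rfl fun i hi => ?_
      rw [Finset.mem_Ico] at hi
      rw [Set.indicator_of_mem (show i ∈ Set.Icc o θ from ⟨hi.1, hi.2.le⟩)]
      simp [leftMass, hi.2]
    · intro i hi
      by_cases h' : i < θ
      · rw [Set.indicator_of_notMem]
        · simp
        · intro h''
          exact hi (Finset.mem_Ico.2 ⟨h''.1, h'⟩)
      · simp [leftMass, h']
  -- The drop after `θ` costs nothing, since that edge belongs to the right half.
  have he : energy (leftCond K θ) ((Set.Icc o θ).indicator 1) = leftCond K θ (o - 1) := by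
    unfold energy
    rw [tsum_eq_single (o - 1)]
    · rw [Set.indicator_of_mem (show o - 1 + 1 ∈ Set.Icc o θ from ⟨by omega, by omega⟩),
        Set.indicator_of_notMem (show o - 1 ∉ Set.Icc o θ from fun h => by have := h.1; omega)]
      simp
    · intro i hi
      by_cases h' : i < θ
      · have : (i + 1 ∈ Set.Icc o θ) ↔ (i ∈ Set.Icc o θ) := by
          simp only [Set.mem_Icc]
          omega
        simp [Set.indicator_apply, this]
      · simp [leftCond, h']
  rwa [hm, he] at h1

/-- Testing the right inequality with the indicator of `[θ, o]`. -/
lemma Poincare.sum_le_right [E.OrdConnected] (ho : o ∈ E) (hθ : θ ∈ E) (hoθ : θ ≤ o)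
    (h : Poincare E (rightMass μ θ 0) (rightCond K θ) r) :
    r * ∑ i ∈ Finset.Icc θ o, μ i ≤ K o := by
  have hf := finSupp_indicator hθ ho
  have h1 := h _ hf
  have hm : mass (rightMass μ θ 0) ((Set.Icc θ o).indicator 1) = ∑ i ∈ Finset.Icc θ o, μ i := by
    unfold mass
    rw [tsum_eq_sum (s := Finset.Icc θ o)]
    · refine Finset.sum_congr rfl fun i hi => ?_
      rw [Finset.mem_Icc] at hi
      rw [Set.indicator_of_mem (show i ∈ Set.Icc θ o from hi)]
      rcases hi.1.eq_or_lt with rfl | h'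
      · simp [rightMass]
      · simp [rightMass, h']
    · intro i hi
      rw [Set.indicator_of_notMem]
      · simp
      · intro h''
        exact hi (Finset.mem_Icc.2 h'')
  have he : energy (rightCond K θ) ((Set.Icc θ o).indicator 1) = K o := by
    unfold energy
    rw [tsum_eq_single o]
    · rw [Set.indicator_of_mem (show o ∈ Set.Icc θ o from ⟨hoθ, le_rfl⟩),
        Set.indicator_of_notMem (show o + 1 ∉ Set.Icc θ o from fun h => by have := h.2; omega)]
      simp [rightCond, hoθ]
    · intro i hi
      by_cases h' : θ ≤ i
      · have : (i + 1 ∈ Set.Icc θ o) ↔ (i ∈ Set.Icc θ o) := by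
          simp only [Set.mem_Icc]
          omega
        simp [Set.indicator_apply, this]
      · simp [rightCond, h']
  rwa [hm, he] at h1

/-- If each one-sided inequality at `θ` holds for some division of the mass at `θ`, then both hold
simultaneously for some division. -/
lemma exists_common {p q : ℝ} (hμ : ∀ i, 0 ≤ μ i) (hr : 0 ≤ r) (h : Poincare E μ K r)
    (hp0 : 0 < p) (hq0 : 0 < q) (hq1 : q < 1)
    (hp : Poincare E (leftMass μ θ p) (leftCond K θ) r)
    (hq : Poincare E (rightMass μ θ q) (rightCond K θ) r) :
    ∃ t, 0 < t ∧ t < 1 ∧ Poincare E (leftMass μ θ t) (leftCond K θ) r ∧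
      Poincare E (rightMass μ θ t) (rightCond K θ) r := by
  rcases le_total q p with hqp | hpq
  · exact ⟨q, hq0, hq1, hp.mono_mass hr (leftMass_mono hμ hqp), hq⟩
  -- Two closed sets cover `[p, q]` by `Poincare.left_or_right`; the left one contains `p`, the
  -- right one `q`, so they meet.
  · obtain ⟨t, ht, hl, hr⟩ := isPreconnected_closed_iff.1 (isPreconnected_Icc (a := p) (b := q))
      _ _ isClosed_poincare_left isClosed_poincare_right
      (fun t _ => h.left_or_right θ t) ⟨p, ⟨le_rfl, hpq⟩, hp⟩ ⟨q, ⟨hpq, le_rfl⟩, hq⟩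
    exact ⟨t, hp0.trans_le ht.1, ht.2.trans_lt hq1, hl, hr⟩

/-- Existence of a splitting for which both one-sided inequalities hold. -/
lemma exists_splitting [E.OrdConnected] (hμ : ∀ i, 0 ≤ μ i) (hμE : ∀ i ∈ E, 0 < μ i)
    (hK : ∀ i, 0 ≤ K i) (hKE : ∀ i ∈ E, 0 < K i) (hKE' : ∀ i, i + 1 ∈ E → 0 < K i)
    (ho : o ∈ E) (hr : 0 < r) (hrr : r < r') (h : Poincare E μ K r')
    (hlo : (∃ l, IsLeast E l) ∨ ∀ C, ∃ θ ∈ E, θ ≤ o ∧ C < ∑ i ∈ Finset.Icc θ o, μ i)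
    (hhi : (∃ u, IsGreatest E u) ∨ ∀ C, ∃ θ ∈ E, o ≤ θ ∧ C < ∑ i ∈ Finset.Icc o θ, μ i) :
    ∃ θ ∈ E, ∃ t, 0 < t ∧ t < 1 ∧ Poincare E (leftMass μ θ t) (leftCond K θ) r ∧
      Poincare E (rightMass μ θ t) (rightCond K θ) r := by
  have hr' := hr.trans hrr
  have hweak : ∀ {w k : ℤ → ℝ}, (∀ i, 0 ≤ w i) → Poincare E w k r' → Poincare E w k r :=
    fun hw hP f hf => (mul_le_mul_of_nonneg_right hrr.le (mass_nonneg hw f)).trans (hP f hf)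
  let A : ℤ → Prop := fun θ => θ ∈ E ∧ Poincare E (leftMass μ θ 0) (leftCond K θ) r'
  have hne : ∃ θ, A θ := by
    rcases hlo with ⟨l, hl⟩ | hlo
    · refine ⟨l, hl.1, fun f hf => ?_⟩
      have : mass (leftMass μ l 0) f = mass (fun _ => 0) f := by
        refine mass_congr fun i => ?_
        unfold leftMass
        by_cases hi : i < l
        · simp [hf.eq_zero fun hE => (hl.2 hE).not_gt hi]
        · simp [hi]
      have h0 : mass (fun _ => 0) f = 0 := by simp [mass]
      rw [this, h0, mul_zero]
      exact energy_nonneg (leftCond_nonneg hK) f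
    · obtain ⟨θ, hθ, hθo, hC⟩ := hlo (K o / r')
      -- Far to the left, `[θ, o]` has too much mass for the right inequality, so the left one
      -- holds.
      refine ⟨θ, hθ, (h.left_or_right θ 0).resolve_right fun hR => ?_⟩
      have := hR.sum_le_right ho hθ hθo
      rw [div_lt_iff₀ hr'] at hC
      linarith
  have hbdd : ∃ B, ∀ θ, A θ → θ ≤ B := by
    rcases hhi with ⟨u, hu⟩ | hhi
    · exact ⟨u, fun θ hθ => hu.2 hθ.1⟩
    · obtain ⟨B, hB, hoB, hC⟩ := hhi (K (o - 1) / r')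
      refine ⟨B, fun θ hθ => ?_⟩
      by_contra hlt
      have h1 := hθ.2.sum_le_left ho hθ.1 (by omega)
      have h2 : leftCond K θ (o - 1) ≤ K (o - 1) := by
        unfold leftCond
        split_ifs
        · exact le_rfl
        · exact hK _
      have h3 : ∑ i ∈ Finset.Icc o B, μ i ≤ ∑ i ∈ Finset.Ico o θ, μ i := by
        refine Finset.sum_le_sum_of_subset_of_nonneg (fun i hi => ?_) fun i _ _ => hμ i
        rw [Finset.mem_Icc] at hi
        rw [Finset.mem_Ico]
        omega
      rw [div_lt_iff₀ hr'] at hC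
      have := mul_le_mul_of_nonneg_left h3 hr'.le
      linarith
  obtain ⟨θ, ⟨hθ, hA⟩, hmax⟩ := Int.exists_greatest_of_bdd hbdd hne
  obtain ⟨p, hp0, -, hp⟩ := exists_left_pos hμ hμE hK hKE' hθ hr hrr hA
  have hQ : ∃ q, 0 < q ∧ q < 1 ∧ Poincare E (rightMass μ θ q) (rightCond K θ) r := by
    by_cases hs : θ + 1 ∈ E
    -- By maximality of `θ` the left inequality fails at `t = 1`. Failure is an open condition, so
    -- it persists for some `q < 1`, where the right inequality must then hold.
    · have hn : ¬ Poincare E (leftMass μ θ 1) (leftCond K θ) r' := fun hP => by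
        have := hmax _ ⟨hs, hP.left_succ hK⟩
        omega
      have hopen := (isClosed_poincare_left (E := E) (μ := μ) (K := K) (θ := θ)
        (r := r')).isOpen_compl.mem_nhds (show (1 : ℝ) ∈ _ from hn)
      obtain ⟨q, hq, hq1⟩ := Filter.nonempty_of_mem (Filter.inter_mem
        (mem_nhdsWithin_of_mem_nhds hopen) (Ioo_mem_nhdsLT (zero_lt_one' ℝ)))
      exact ⟨q, hq1.1, hq1.2, hweak (rightMass_nonneg hμ hq1.2.le)
        ((h.left_or_right θ q).resolve_left hq)⟩
    · refine exists_right_of_greatest hμE hK hKE ⟨hθ, fun i hi => ?_⟩ hr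
      by_contra hlt
      exact hs (Set.Icc_subset E hθ hi ⟨by omega, by omega⟩)
  obtain ⟨q, hq0, hq1, hq⟩ := hQ
  exact ⟨θ, hθ, exists_common hμ hr.le (hweak hμ h) hp0 hq0 hq1 hp hq⟩

end existence

/-! ### The symmetrizing measure and changes of rates -/

section symm

variable {E : Set ℤ} {a b : ℤ → ℝ} {o θ i : ℤ}

lemma symmMeasure_self (a b : ℤ → ℝ) (o : ℤ) : symmMeasure a b o o = 1 / (a o * b o) := by
  simp [symmMeasure]

lemma symmMeasure_of_lt (a b : ℤ → ℝ) (h : o < i) :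
    symmMeasure a b o i = (∏ j ∈ Finset.Ioo o i, b j) / ∏ j ∈ Finset.Icc o i, a j := by
  simp [symmMeasure, h]

lemma symmMeasure_of_gt (a b : ℤ → ℝ) (h : i < o) :
    symmMeasure a b o i = (∏ j ∈ Finset.Ioo i o, a j) / ∏ j ∈ Finset.Icc i o, b j := by
  simp [symmMeasure, h, h.not_gt]

lemma symmMeasure_pos [E.OrdConnected] (ha : ∀ i ∈ E, 0 < a i) (hb : ∀ i ∈ E, 0 < b i)
    (ho : o ∈ E) (hi : i ∈ E) : 0 < symmMeasure a b o i := by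
  rcases lt_trichotomy o i with h | rfl | h
  · rw [symmMeasure_of_lt a b h]
    refine div_pos (Finset.prod_pos fun j hj => hb j ?_) (Finset.prod_pos fun j hj => ha j ?_)
    · exact Set.Icc_subset E ho hi (Set.Ioo_subset_Icc_self (Finset.mem_Ioo.1 hj))
    · exact Set.Icc_subset E ho hi (Finset.mem_Icc.1 hj)
  · rw [symmMeasure_self]
    have := ha o ho
    have := hb o ho
    positivity
  · rw [symmMeasure_of_gt a b h]
    refine div_pos (Finset.prod_pos fun j hj => ha j ?_) (Finset.prod_pos fun j hj => hb j ?_)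
    · exact Set.Icc_subset E hi ho (Set.Ioo_subset_Icc_self (Finset.mem_Ioo.1 hj))
    · exact Set.Icc_subset E hi ho (Finset.mem_Icc.1 hj)

/-- Detailed balance. -/
lemma symmMeasure_balance (hi : b i ≠ 0) (hi' : a (i + 1) ≠ 0) :
    symmMeasure a b o i * b i = symmMeasure a b o (i + 1) * a (i + 1) := by
  rcases lt_trichotomy o i with h | rfl | h
  · rw [symmMeasure_of_lt a b h, symmMeasure_of_lt a b (show o < i + 1 by omega),
      show Finset.Ioo o (i + 1) = insert i (Finset.Ioo o i) by ext j; simp; omega,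
      show Finset.Icc o (i + 1) = insert (i + 1) (Finset.Icc o i) by ext j; simp; omega,
      Finset.prod_insert (by simp), Finset.prod_insert (by simp)]
    field_simp
  · rw [symmMeasure_self, symmMeasure_of_lt a b (show o < o + 1 by omega),
      show Finset.Ioo o (o + 1) = ∅ by ext j; simp,
      show Finset.Icc o (o + 1) = {o, o + 1} by ext j; simp; omega,
      Finset.prod_pair (by omega), Finset.prod_empty]
    field_simp
  · rcases (show i + 1 ≤ o from h).eq_or_lt with rfl | h'
    · rw [symmMeasure_self, symmMeasure_of_gt a b (show i < i + 1 by omega),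
        show Finset.Ioo i (i + 1) = ∅ by ext j; simp,
        show Finset.Icc i (i + 1) = {i, i + 1} by ext j; simp; omega,
        Finset.prod_pair (by omega), Finset.prod_empty]
      field_simp
    · rw [symmMeasure_of_gt a b h, symmMeasure_of_gt a b h',
        show Finset.Ioo i o = insert (i + 1) (Finset.Ioo (i + 1) o) by ext j; simp; omega,
        show Finset.Icc i o = insert i (Finset.Icc (i + 1) o) by ext j; simp; omega,
        Finset.prod_insert (by simp), Finset.prod_insert (by simp)]
      field_simp

/-- Changing the reference point multiplies the measure by a constant. -/
lemma exists_symmMeasure_eq_mul [E.OrdConnected] (ha : ∀ i ∈ E, 0 < a i)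
    (hb : ∀ i ∈ E, 0 < b i) (ho : o ∈ E) (hθ : θ ∈ E) :
    ∃ κ, 0 < κ ∧ ∀ i ∈ E, symmMeasure a b θ i = κ * symmMeasure a b o i := by
  have h0 := symmMeasure_pos ha hb ho hθ
  refine ⟨symmMeasure a b θ θ / symmMeasure a b o θ,
    div_pos (symmMeasure_pos ha hb hθ hθ) h0, ?_⟩
  generalize hκ : symmMeasure a b θ θ / symmMeasure a b o θ = κ
  have hbase : symmMeasure a b θ θ = κ * symmMeasure a b o θ := by
    rw [← hκ, div_mul_cancel₀ _ h0.ne']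
  intro i
  -- Detailed balance fixes the ratio of neighbouring weights independently of the reference point.
  induction i using Int.inductionOn' (b := θ) with
  | zero => exact fun _ => hbase
  | succ k hk ih =>
    intro hi
    have hkE : k ∈ E := Set.Icc_subset E hθ hi ⟨hk, by omega⟩
    have hak := (ha _ hi).ne'
    have hbk := (hb _ hkE).ne'
    refine mul_right_cancel₀ hak ?_
    rw [mul_assoc, ← symmMeasure_balance hbk hak, ← symmMeasure_balance hbk hak, ih hkE, mul_assoc]
  | pred k hk ih =>
    intro hi
    have hkE : k ∈ E := Set.Icc_subset E hi hθ ⟨by omega, hk⟩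
    have hak : a (k - 1 + 1) ≠ 0 := by
      rw [sub_add_cancel]
      exact (ha _ hkE).ne'
    have hbk := (hb _ hi).ne'
    refine mul_right_cancel₀ hbk ?_
    rw [mul_assoc, symmMeasure_balance hbk hak, symmMeasure_balance hbk hak, sub_add_cancel,
      ih hkE, mul_assoc]

/-- With reference point `θ`, the rate `a θ` enters no weight to the left of `θ`, only the weight at
`θ`. -/
lemma symmMeasure_update_left {c : ℝ} (hi : i ≤ θ) :
    symmMeasure (Function.update a θ (c * a θ)) b θ i =
      if i < θ then symmMeasure a b θ i else c⁻¹ * symmMeasure a b θ θ := by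
  rcases hi.eq_or_lt with rfl | h
  · simp only [symmMeasure_self, Function.update_self, lt_irrefl, if_false]
    rw [mul_assoc, one_div, one_div, mul_inv]
  · rw [if_pos h, symmMeasure_of_gt _ _ h, symmMeasure_of_gt _ _ h]
    congr 1
    refine Finset.prod_congr rfl fun j hj => Function.update_of_ne ?_ _ _
    exact (Finset.mem_Ioo.1 hj).2.ne

lemma symmMeasure_update_right {c : ℝ} (hi : θ ≤ i) :
    symmMeasure a (Function.update b θ (c * b θ)) θ i =
      if θ < i then symmMeasure a b θ i else c⁻¹ * symmMeasure a b θ θ := by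
  rcases hi.eq_or_lt with rfl | h
  · simp only [symmMeasure_self, Function.update_self, lt_irrefl, if_false]
    rw [mul_left_comm, one_div, one_div, mul_inv]
  · rw [if_pos h, symmMeasure_of_lt _ _ h, symmMeasure_of_lt _ _ h]
    congr 1
    refine Finset.prod_congr rfl fun j hj => Function.update_of_ne ?_ _ _
    exact (Finset.mem_Ioo.1 hj).1.ne'

end symm

/-- The conductance `μ_{i+1} a_{i+1} = μ_i b_i` of the edge `{i, i+1}`. -/
noncomputable def conductance (E : Set ℤ) (μ a b : ℤ → ℝ) : ℤ → ℝ :=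
  open Classical in
  fun i => if i + 1 ∈ E then μ (i + 1) * a (i + 1) else if i ∈ E then μ i * b i else 0

/-! ### Dirichlet forms as energies of edges -/

section form

variable {E : Set ℤ} {μ a b : ℤ → ℝ} {o θ : ℤ}

lemma conductance_of_mem_right {i : ℤ} (hi : i + 1 ∈ E) :
    conductance E μ a b i = μ (i + 1) * a (i + 1) := if_pos hi

lemma conductance_of_mem {i : ℤ} (hbal : ∀ i ∈ E, i + 1 ∈ E → μ i * b i = μ (i + 1) * a (i + 1))
    (hi : i ∈ E) : conductance E μ a b i = μ i * b i := by
  unfold conductance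
  split_ifs with h
  · exact (hbal i hi h).symm
  · rfl

lemma conductance_of_notMem {i : ℤ} (hi : i ∉ E) (hi' : i + 1 ∉ E) :
    conductance E μ a b i = 0 := by
  simp [conductance, hi, hi']

lemma leftEnergy_eq (S : Set ℤ) (μ a f : ℤ → ℝ) :
    leftEnergy S μ a f = energy (fun i => S.indicator (fun j => μ j * a j) (i + 1)) f := by
  unfold leftEnergy energy
  rw [tsum_subtype S fun i => μ i * a i * (f i - f (i - 1)) ^ 2,
    ← (Equiv.addRight (1 : ℤ)).tsum_eq]
  refine tsum_congr fun i => ?_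
  by_cases h : i + 1 ∈ S <;> simp [h]

lemma rightEnergy_eq (S : Set ℤ) (μ b f : ℤ → ℝ) :
    rightEnergy S μ b f = energy (S.indicator fun j => μ j * b j) f := by
  unfold rightEnergy energy
  rw [tsum_subtype S fun i => μ i * b i * (f (i + 1) - f i) ^ 2]
  refine tsum_congr fun i => ?_
  by_cases h : i ∈ S <;> simp [h]

/-- An edge left of `θ` whose right end is outside `E` has its left end outside as well, by
convexity, so it has no conductance. -/
lemma leftEnergy_eq_energy [E.OrdConnected] (hθ : θ ∈ E) (f : ℤ → ℝ) :
    leftEnergy (E ∩ Set.Iic θ) μ a f = energy (leftCond (conductance E μ a b) θ) f := by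
  rw [leftEnergy_eq]
  refine energy_congr fun i => ?_
  congr 1
  unfold leftCond
  by_cases hi : i < θ
  · rw [if_pos hi]
    by_cases h : i + 1 ∈ E
    · rw [conductance_of_mem_right h, Set.indicator_of_mem (show i + 1 ∈ E ∩ Set.Iic θ from ⟨h, hi⟩)]
    · rw [conductance_of_notMem (fun h' => h (Set.Icc_subset E h' hθ ⟨by omega, by omega⟩)) h,
        Set.indicator_of_notMem fun h' => h h'.1]
  · rw [if_neg hi, Set.indicator_of_notMem]
    intro h
    exact hi (show i + 1 ≤ θ from h.2)

lemma rightEnergy_eq_energy [E.OrdConnected]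
    (hbal : ∀ i ∈ E, i + 1 ∈ E → μ i * b i = μ (i + 1) * a (i + 1)) (hθ : θ ∈ E) (f : ℤ → ℝ) :
    rightEnergy (E ∩ Set.Ici θ) μ b f = energy (rightCond (conductance E μ a b) θ) f := by
  rw [rightEnergy_eq]
  refine energy_congr fun i => ?_
  congr 1
  unfold rightCond
  by_cases hi : θ ≤ i
  · rw [if_pos hi]
    by_cases h : i ∈ E
    · rw [conductance_of_mem hbal h, Set.indicator_of_mem (show i ∈ E ∩ Set.Ici θ from ⟨h, hi⟩)]
    · rw [conductance_of_notMem h fun h' => h (Set.Icc_subset E hθ h' ⟨by omega, by omega⟩),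
        Set.indicator_of_notMem fun h' => h h'.1]
  · rw [if_neg hi, Set.indicator_of_notMem]
    exact fun h => hi h.2

lemma conductance_nonneg (hμ : ∀ i ∈ E, 0 < μ i) (ha : ∀ i ∈ E, 0 < a i) (hb : ∀ i ∈ E, 0 < b i)
    (i : ℤ) : 0 ≤ conductance E μ a b i := by
  unfold conductance
  split_ifs with h h'
  · exact (mul_pos (hμ _ h) (ha _ h)).le
  · exact (mul_pos (hμ _ h') (hb _ h')).le
  · exact le_rfl

lemma mass_indicator {f : ℤ → ℝ} (hf : FinSupp E f) (μ : ℤ → ℝ) :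
    mass (E.indicator μ) f = mass μ f := by
  refine mass_congr fun i => ?_
  by_cases h : i ∈ E
  · rw [Set.indicator_of_mem h]
  · simp [hf.eq_zero h]

end form

/-! ### Eigenvalues as optimal Poincaré constants -/

section variational

variable {E S : Set ℤ} {ν w k : ℤ → ℝ} {D : (ℤ → ℝ) → ℝ} {κ r : ℝ}

/-- A real number is a lower bound of the first eigenvalue iff it is a Poincaré constant. -/
lemma le_firstEigenvalue_iff (hκ : 0 < κ) (hw : ∀ i, 0 ≤ w i) (hk : ∀ i, 0 ≤ k i)
    (hν : ∀ f, FinSupp S f → mass ν f = κ * mass w f)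
    (hD : ∀ f, FinSupp S f → D f = κ * energy k f) :
    (r : EReal) ≤ firstEigenvalue S ν D ↔ Poincare S w k r := by
  unfold firstEigenvalue
  rw [le_iInf₂_iff]
  constructor
  · intro h f hf
    -- A function of zero mass cannot be normalized, but its inequality is trivial; otherwise `c`
    -- rescales `f` to unit mass.
    rcases (mass_nonneg hw f).eq_or_lt with h0 | hpos
    · rw [← h0, mul_zero]
      exact energy_nonneg hk f
    · have hm : 0 < κ * mass w f := mul_pos hκ hpos
      set c := (Real.sqrt (κ * mass w f))⁻¹ with hc
      have hc2 : c ^ 2 = (κ * mass w f)⁻¹ := by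
        rw [hc, inv_pow, Real.sq_sqrt hm.le]
      have hg := hf.smul c
      have h1 := h _ ⟨hg.1, hg.2, by
        change mass ν _ = 1
        rw [hν _ hg, mass_smul, hc2, mul_left_comm, inv_mul_cancel₀ hm.ne']⟩
      rw [EReal.coe_le_coe_iff, hD _ hg, energy_smul, hc2] at h1
      have h2 : κ * ((κ * mass w f)⁻¹ * energy k f) = energy k f / mass w f := by
        field_simp
      rwa [h2, le_div_iff₀ hpos] at h1
  · intro h f hf
    have hf' : FinSupp S f := ⟨hf.1, hf.2.1⟩
    have h1 : κ * mass w f = 1 := (hν f hf').symm.trans hf.2.2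
    rw [EReal.coe_le_coe_iff, hD f hf']
    calc r = κ * (r * mass w f) := by rw [mul_left_comm, h1, mul_one]
      _ ≤ κ * energy k f := mul_le_mul_of_nonneg_left (h f hf') hκ.le

/-- Truncating `f` to `T` changes neither mass nor energy, since every edge of nonzero conductance
has both ends in `T`. Both halves can thus be tested with functions on all of `E`. -/
lemma Poincare.restrict_iff (T : Set ℤ) (hw : ∀ i ∉ T, w i = 0)
    (hk : ∀ i, k i ≠ 0 → i ∈ T ∧ i + 1 ∈ T) :
    Poincare (E ∩ T) w k r ↔ Poincare E w k r := by
  constructor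
  · intro h f hf
    have hg : FinSupp (E ∩ T) (T.indicator f) := by
      refine ⟨hf.1.subset ?_, ?_⟩
      · rw [Set.support_indicator]
        exact Set.inter_subset_right
      · rw [Set.support_indicator]
        exact fun i hi => ⟨hf.2 hi.2, hi.1⟩
    have hm : mass w (T.indicator f) = mass w f := by
      refine mass_congr fun i => ?_
      by_cases hi : i ∈ T
      · rw [Set.indicator_of_mem hi]
      · simp [hw i hi]
    have he : energy k (T.indicator f) = energy k f := by
      refine energy_congr fun i => ?_
      by_cases hi : k i = 0
      · simp [hi]
      · rw [Set.indicator_of_mem (hk i hi).1, Set.indicator_of_mem (hk i hi).2]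
    rw [← hm, ← he]
    exact h _ hg
  · exact fun h f hf => h f ⟨hf.1, hf.2.trans Set.inter_subset_left⟩

end variational

instance ordConnected_stateSpace (M N : WithTop ℤ) : (stateSpace M N).OrdConnected := by
  refine ⟨fun x hx y hy z hz => ⟨le_trans ?_ hx.1, le_trans ?_ hy.2⟩⟩
  · exact WithTop.coe_le_coe.2 (neg_le_neg hz.1)
  · exact WithTop.coe_le_coe.2 hz.2

/-! ### The eigenvalues of the birth–death process -/

section eigenvalues

variable {M N : WithTop ℤ} {a b : ℤ → ℝ} {o θ : ℤ} {γ r : ℝ}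

/-- The symmetrizing measure, extended by zero outside the state space. -/
noncomputable def stateMeasure (M N : WithTop ℤ) (a b : ℤ → ℝ) (o : ℤ) : ℤ → ℝ :=
  (stateSpace M N).indicator (symmMeasure a b o)

/-- The conductances of the process on the state space. -/
noncomputable def stateCond (M N : WithTop ℤ) (a b : ℤ → ℝ) (o : ℤ) : ℤ → ℝ :=
  conductance (stateSpace M N) (symmMeasure a b o) a b

variable (ho : o ∈ stateSpace M N) (ha : ∀ i ∈ stateSpace M N, 0 < a i)
  (hb : ∀ i ∈ stateSpace M N, 0 < b i)

include ha hb in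
lemma stateSpace_balance :
    ∀ i ∈ stateSpace M N, i + 1 ∈ stateSpace M N →
      symmMeasure a b o i * b i = symmMeasure a b o (i + 1) * a (i + 1) :=
  fun i hi hi' => symmMeasure_balance (hb i hi).ne' (ha _ hi').ne'

include ho ha hb in
lemma stateMeasure_pos : ∀ i ∈ stateSpace M N, 0 < stateMeasure M N a b o i := fun i hi => by
  rw [stateMeasure, Set.indicator_of_mem hi]
  exact symmMeasure_pos ha hb ho hi

include ho ha hb in
lemma stateMeasure_nonneg (i : ℤ) : 0 ≤ stateMeasure M N a b o i :=
  Set.indicator_nonneg (fun _ hi => (symmMeasure_pos ha hb ho hi).le) i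

include ho ha hb in
lemma stateCond_nonneg (i : ℤ) : 0 ≤ stateCond M N a b o i :=
  conductance_nonneg (fun _ hi => symmMeasure_pos ha hb ho hi) ha hb i

include ho ha hb in
lemma stateCond_pos : ∀ i ∈ stateSpace M N, 0 < stateCond M N a b o i := fun i hi => by
  rw [stateCond, conductance_of_mem (stateSpace_balance ha hb) hi]
  exact mul_pos (symmMeasure_pos ha hb ho hi) (hb i hi)

include ho ha hb in
lemma stateCond_pos' : ∀ i, i + 1 ∈ stateSpace M N → 0 < stateCond M N a b o i := fun i hi => by
  rw [stateCond, conductance_of_mem_right hi]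
  exact mul_pos (symmMeasure_pos ha hb ho hi) (ha _ hi)

include ho ha hb in
lemma dirichletForm_eq {f : ℤ → ℝ} (hf : FinSupp (stateSpace M N) f) :
    dirichletForm M N a b o f = energy (stateCond M N a b o) f := by
  unfold dirichletForm stateCond
  rw [leftEnergy_eq_energy (b := b) ho f, rightEnergy_eq_energy (stateSpace_balance ha hb) ho f,
    energy_left_add_right hf.1]

include ho ha hb in
lemma le_lam0_iff :
    (r : EReal) ≤ lam0 M N a b o ↔
      Poincare (stateSpace M N) (stateMeasure M N a b o) (stateCond M N a b o) r := by
  refine le_firstEigenvalue_iff one_pos (stateMeasure_nonneg ho ha hb)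
    (stateCond_nonneg ho ha hb) (fun f hf => ?_) fun f hf => ?_
  · rw [one_mul, stateMeasure, mass_indicator hf]
  · rw [one_mul, dirichletForm_eq ho ha hb hf]

-- Replacing `a θ` by `γ * a θ` divides the mass at `θ` by `γ` and preserves the product of mass and
-- death rate there. Passing from reference point `o` to `θ` scales mass and energy by the same `κ`.
include ho ha hb in
lemma le_lamMinus_iff (hθ : θ ∈ stateSpace M N) (hγ : 1 < γ) :
    (r : EReal) ≤ lamMinus M N a b θ γ ↔
      Poincare (stateSpace M N) (leftMass (stateMeasure M N a b o) θ γ⁻¹)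
        (leftCond (stateCond M N a b o) θ) r := by
  have hγ0 : 0 < γ := one_pos.trans hγ
  obtain ⟨κ, hκ, hμ⟩ := exists_symmMeasure_eq_mul ha hb ho hθ
  rw [← Poincare.restrict_iff (Set.Iic θ)]
  · refine le_firstEigenvalue_iff hκ
      (leftMass_nonneg (stateMeasure_nonneg ho ha hb) (inv_pos.2 hγ0).le)
      (leftCond_nonneg (stateCond_nonneg ho ha hb)) (fun f hf => ?_) fun f _ => ?_
    · rw [← mass_const_mul]
      refine mass_congr fun i => ?_
      by_cases hi : i ∈ stateSpace M N ∩ Set.Iic θ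
      · congr 1
        rw [symmMeasure_update_left hi.2, hμ i hi.1, hμ θ hθ, leftMass, stateMeasure,
          Set.indicator_of_mem hi.1, Set.indicator_of_mem hθ]
        rcases (show i ≤ θ from hi.2).eq_or_lt with rfl | h
        · simp only [lt_irrefl, if_false, if_true]
          ring
        · simp [h]
      · simp [hf.eq_zero hi]
    · rw [stateCond, ← leftEnergy_eq_energy hθ]
      unfold leftEnergy
      rw [← tsum_mul_left]
      refine tsum_congr fun i => ?_
      rw [← mul_assoc]
      congr 1
      rw [symmMeasure_update_left i.2.2, hμ i i.2.1, hμ θ hθ]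
      rcases (show (i : ℤ) ≤ θ from i.2.2).eq_or_lt with h | h
      · rw [h]
        simp only [lt_irrefl, if_false, Function.update_self]
        field_simp
      · rw [if_pos h, Function.update_of_ne h.ne, mul_assoc]
  · intro i hi
    rw [Set.mem_Iic] at hi
    simp [leftMass, show ¬ i < θ by omega, show i ≠ θ by omega]
  · intro i hi
    simp only [leftCond, ne_eq, ite_eq_right_iff, not_forall] at hi
    obtain ⟨hi, -⟩ := hi
    exact ⟨hi.le, show i + 1 ≤ θ from hi⟩

include ho ha hb in
lemma le_lamPlus_iff (hθ : θ ∈ stateSpace M N) (hγ : 1 < γ) :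
    (r : EReal) ≤ lamPlus M N a b θ γ ↔
      Poincare (stateSpace M N) (rightMass (stateMeasure M N a b o) θ γ⁻¹)
        (rightCond (stateCond M N a b o) θ) r := by
  have hγ0 : 0 < γ := one_pos.trans hγ
  have hγ1 : γ - 1 ≠ 0 := (sub_pos.2 hγ).ne'
  -- This is why the birth rate is multiplied by `γ / (γ - 1)`: the two fractions of the mass at `θ`
  -- add up to 1.
  have hγi : (γ * (γ - 1)⁻¹)⁻¹ = 1 - γ⁻¹ := by
    field_simp
  obtain ⟨κ, hκ, hμ⟩ := exists_symmMeasure_eq_mul ha hb ho hθ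
  rw [← Poincare.restrict_iff (Set.Ici θ)]
  · refine le_firstEigenvalue_iff hκ
      (rightMass_nonneg (stateMeasure_nonneg ho ha hb) (inv_le_one_of_one_le₀ hγ.le))
      (rightCond_nonneg (stateCond_nonneg ho ha hb)) (fun f hf => ?_) fun f _ => ?_
    · rw [← mass_const_mul]
      refine mass_congr fun i => ?_
      by_cases hi : i ∈ stateSpace M N ∩ Set.Ici θ
      · congr 1
        rw [symmMeasure_update_right hi.2, hμ i hi.1, hμ θ hθ, rightMass, stateMeasure,
          Set.indicator_of_mem hi.1, Set.indicator_of_mem hθ, hγi]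
        rcases (show θ ≤ i from hi.2).eq_or_lt with rfl | h
        · simp only [lt_irrefl, if_false, if_true]
          ring
        · simp [h]
      · simp [hf.eq_zero hi]
    · rw [stateCond, ← rightEnergy_eq_energy (stateSpace_balance ha hb) hθ]
      unfold rightEnergy
      rw [← tsum_mul_left]
      refine tsum_congr fun i => ?_
      rw [← mul_assoc]
      congr 1
      rw [symmMeasure_update_right i.2.2, hμ i i.2.1, hμ θ hθ]
      rcases (show θ ≤ (i : ℤ) from i.2.2).eq_or_lt with h | h
      · rw [← h]
        simp only [lt_irrefl, if_false, Function.update_self]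
        field_simp
      · rw [if_pos h, Function.update_of_ne h.ne', mul_assoc]
  · intro i hi
    rw [Set.mem_Ici] at hi
    simp [rightMass, show ¬ θ < i by omega, show i ≠ θ by omega]
  · intro i hi
    simp only [rightCond, ne_eq, ite_eq_right_iff, not_forall] at hi
    obtain ⟨hi, -⟩ := hi
    exact ⟨hi, show θ ≤ i + 1 by omega⟩

lemma le_of_poincare_of_rayleigh {E : Set ℤ} {w k : ℤ → ℝ} {x : EReal} {R : ℝ} {f : ℤ → ℝ}
    (hx : ∀ r : ℝ, (r : EReal) ≤ x → Poincare E w k r) (hf : FinSupp E f)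
    (hpos : 0 < mass w f) (hR : energy k f ≤ R * mass w f) : x ≤ R := by
  refine EReal.ge_of_forall_gt_iff_ge.1 fun z hz => EReal.coe_le_coe_iff.2 ?_
  exact le_of_mul_le_mul_right ((hx z hz.le f hf).trans hR) hpos

include ho ha hb in
lemma lam0_le_lamMinus_sup_lamPlus (hθ : θ ∈ stateSpace M N) (hγ : 1 < γ) :
    lam0 M N a b o ≤ lamMinus M N a b θ γ ⊔ lamPlus M N a b θ γ := by
  refine EReal.ge_of_forall_gt_iff_ge.1 fun z hz => ?_
  rcases ((le_lam0_iff ho ha hb).1 hz.le).left_or_right θ γ⁻¹ with h | h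
  · exact le_sup_of_le_left ((le_lamMinus_iff ho ha hb hθ hγ).2 h)
  · exact le_sup_of_le_right ((le_lamPlus_iff ho ha hb hθ hγ).2 h)

include ho ha hb in
lemma lamMinus_inf_lamPlus_le_lam0 (hθ : θ ∈ stateSpace M N) (hγ : 1 < γ) :
    lamMinus M N a b θ γ ⊓ lamPlus M N a b θ γ ≤ lam0 M N a b o := by
  refine EReal.ge_of_forall_gt_iff_ge.1 fun z hz => (le_lam0_iff ho ha hb).2 ?_
  obtain ⟨h1, h2⟩ := le_inf_iff.1 hz.le
  exact Poincare.of_split ((le_lamMinus_iff ho ha hb hθ hγ).1 h1)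
    ((le_lamPlus_iff ho ha hb hθ hγ).1 h2)

-- A single test function of quotient below `R` bounds both halves at the cut from `exists_split`,
-- with `γ = t⁻¹`.
include ho ha hb in
lemma iInf_sup_le_lam0 :
    (⨅ θ ∈ stateSpace M N, ⨅ γ ∈ Set.Ioi (1 : ℝ),
      (lamMinus M N a b θ γ ⊔ lamPlus M N a b θ γ)) ≤ lam0 M N a b o := by
  refine EReal.le_of_forall_lt_iff_le.1 fun R hR => ?_
  have hn : ¬ Poincare (stateSpace M N) (stateMeasure M N a b o) (stateCond M N a b o) R :=
    fun h => ((le_lam0_iff ho ha hb).2 h).not_gt hR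
  simp only [Poincare, not_forall, not_le] at hn
  obtain ⟨f, hf, hfR⟩ := hn
  obtain ⟨θ, hθ, t, ht0, ht1, hl, hl0, hr, hr0⟩ :=
    exists_split (stateMeasure_nonneg ho ha hb) (stateCond_nonneg ho ha hb) hf hfR
  have hγ : 1 < t⁻¹ := (one_lt_inv₀ ht0).2 ht1
  refine (iInf₂_le θ hθ).trans ((iInf₂_le t⁻¹ hγ).trans (sup_le ?_ ?_))
  · refine le_of_poincare_of_rayleigh (fun r => (le_lamMinus_iff ho ha hb hθ hγ).1) hf ?_ ?_ <;>
      rwa [inv_inv]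
  · refine le_of_poincare_of_rayleigh (fun r => (le_lamPlus_iff ho ha hb hθ hγ).1) hf ?_ ?_ <;>
      rwa [inv_inv]

-- Reflection only removes the edge to the left boundary, if there is one, and so lowers the energy.
include ho ha hb in
lemma lamReflectLeft_le_lam0 : lamReflectLeft M N a b o ≤ lam0 M N a b o := by
  refine iInf₂_mono fun f hf => EReal.coe_le_coe_iff.2 ?_
  have hf' : FinSupp (stateSpace M N) f := ⟨hf.1, hf.2.1⟩
  rw [dirichletForm_eq ho ha hb hf', rightEnergy_eq]
  refine energy_mono hf.1 fun i => ?_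
  by_cases h : i ∈ stateSpace M N
  · rw [Set.indicator_of_mem h, stateCond, conductance_of_mem (stateSpace_balance ha hb) h]
  · rw [Set.indicator_of_notMem h]
    exact stateCond_nonneg ho ha hb i

include ho ha hb in
lemma lamReflectRight_le_lam0 : lamReflectRight M N a b o ≤ lam0 M N a b o := by
  refine iInf₂_mono fun f hf => EReal.coe_le_coe_iff.2 ?_
  have hf' : FinSupp (stateSpace M N) f := ⟨hf.1, hf.2.1⟩
  rw [dirichletForm_eq ho ha hb hf', leftEnergy_eq]
  refine energy_mono hf.1 fun i => ?_
  by_cases h : i + 1 ∈ stateSpace M N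
  · rw [Set.indicator_of_mem h, stateCond, conductance_of_mem_right h]
  · rw [Set.indicator_of_notMem h]
    exact stateCond_nonneg ho ha hb i

include ho in
lemma exists_isLeast_stateSpace (hM : M ≠ ⊤) : ∃ l, IsLeast (stateSpace M N) l := by
  lift M to ℤ using hM
  have h1 := WithTop.coe_le_coe.1 ho.1
  refine ⟨-M, ⟨?_, (WithTop.coe_le_coe.2 (by omega)).trans ho.2⟩, fun i hi => ?_⟩
  · exact WithTop.coe_le_coe.2 (by omega)
  · have := WithTop.coe_le_coe.1 hi.1
    omega

include ho in
lemma exists_isGreatest_stateSpace (hN : N ≠ ⊤) : ∃ u, IsGreatest (stateSpace M N) u := by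
  lift N to ℤ using hN
  have h1 := WithTop.coe_le_coe.1 ho.2
  refine ⟨N, ⟨(WithTop.coe_le_coe.2 (by omega)).trans ho.1, le_rfl⟩, fun i hi => ?_⟩
  exact WithTop.coe_le_coe.1 hi.2

-- Every nonempty finite set of sites up to `o` lies in an interval `[θ, o]`, so bounded interval
-- sums would force summability.
include ho ha hb in
lemma exists_lt_sum_Icc_of_not_summable_left
    (h : ¬ Summable fun i : ↥(stateSpace M N ∩ Set.Iic o) => symmMeasure a b o i) (C : ℝ) :
    ∃ θ ∈ stateSpace M N, θ ≤ o ∧ C < ∑ i ∈ Finset.Icc θ o, stateMeasure M N a b o i := by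
  by_contra! hC
  refine h (summable_of_sum_le (c := max C 0)
    (fun i => (symmMeasure_pos ha hb ho i.2.1).le) fun s => ?_)
  rcases s.eq_empty_or_nonempty with rfl | hs
  · simp
  · obtain ⟨m, -, hm⟩ := s.exists_min_image (fun i => (i : ℤ)) hs
    refine le_trans ?_ ((hC m m.2.1 m.2.2).trans (le_max_left _ _))
    calc ∑ i ∈ s, symmMeasure a b o i = ∑ i ∈ s, stateMeasure M N a b o i :=
          Finset.sum_congr rfl fun i _ => by rw [stateMeasure, Set.indicator_of_mem i.2.1]
      _ = ∑ i ∈ s.map (Function.Embedding.subtype _), stateMeasure M N a b o i := by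
          rw [Finset.sum_map]
          rfl
      _ ≤ _ := by
          refine Finset.sum_le_sum_of_subset_of_nonneg (fun i hi => ?_)
            fun i _ _ => stateMeasure_nonneg ho ha hb i
          obtain ⟨j, hj, rfl⟩ := Finset.mem_map.1 hi
          exact Finset.mem_Icc.2 ⟨hm j hj, j.2.2⟩

include ho ha hb in
lemma exists_lt_sum_Icc_of_not_summable_right
    (h : ¬ Summable fun i : ↥(stateSpace M N ∩ Set.Ici o) => symmMeasure a b o i) (C : ℝ) :
    ∃ θ ∈ stateSpace M N, o ≤ θ ∧ C < ∑ i ∈ Finset.Icc o θ, stateMeasure M N a b o i := by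
  by_contra! hC
  refine h (summable_of_sum_le (c := max C 0)
    (fun i => (symmMeasure_pos ha hb ho i.2.1).le) fun s => ?_)
  rcases s.eq_empty_or_nonempty with rfl | hs
  · simp
  · obtain ⟨m, -, hm⟩ := s.exists_max_image (fun i => (i : ℤ)) hs
    refine le_trans ?_ ((hC m m.2.1 m.2.2).trans (le_max_left _ _))
    calc ∑ i ∈ s, symmMeasure a b o i = ∑ i ∈ s, stateMeasure M N a b o i :=
          Finset.sum_congr rfl fun i _ => by rw [stateMeasure, Set.indicator_of_mem i.2.1]
      _ = ∑ i ∈ s.map (Function.Embedding.subtype _), stateMeasure M N a b o i := by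
          rw [Finset.sum_map]
          rfl
      _ ≤ _ := by
          refine Finset.sum_le_sum_of_subset_of_nonneg (fun i hi => ?_)
            fun i _ _ => stateMeasure_nonneg ho ha hb i
          obtain ⟨j, hj, rfl⟩ := Finset.mem_map.1 hi
          exact Finset.mem_Icc.2 ⟨j.2.2, hm j hj⟩

include ho ha hb in
lemma lam0_le_iSup_inf
    (hM : M = ⊤ → ¬ Summable fun i : ↥(stateSpace M N ∩ Set.Iic o) => symmMeasure a b o i)
    (hN : N = ⊤ → ¬ Summable fun i : ↥(stateSpace M N ∩ Set.Ici o) => symmMeasure a b o i) :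
    lam0 M N a b o ≤ ⨆ θ ∈ stateSpace M N, ⨆ γ ∈ Set.Ioi (1 : ℝ),
      (lamMinus M N a b θ γ ⊓ lamPlus M N a b θ γ) := by
  have hμ := stateMeasure_nonneg ho ha hb
  have hK := stateCond_nonneg ho ha hb
  refine EReal.ge_of_forall_gt_iff_ge.1 fun r hr => ?_
  obtain ⟨θ, hθ, t, ht0, ht1, hl, hr⟩ : ∃ θ ∈ stateSpace M N, ∃ t : ℝ, 0 < t ∧ t < 1 ∧
      Poincare (stateSpace M N) (leftMass (stateMeasure M N a b o) θ t)
        (leftCond (stateCond M N a b o) θ) r ∧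
      Poincare (stateSpace M N) (rightMass (stateMeasure M N a b o) θ t)
        (rightCond (stateCond M N a b o) θ) r := by
    -- For `r ≤ 0` any cut works. For `r > 0` an intermediate `r' > r` supplies the slack that
    -- `exists_splitting` spends.
    rcases le_or_gt r 0 with hr0 | hr0
    · refine ⟨o, ho, 1 / 2, by norm_num, by norm_num, fun f _ => ?_, fun f _ => ?_⟩
      · exact (mul_nonpos_of_nonpos_of_nonneg hr0
          (mass_nonneg (leftMass_nonneg hμ (by norm_num)) f)).trans
          (energy_nonneg (leftCond_nonneg hK) f)
      · exact (mul_nonpos_of_nonpos_of_nonneg hr0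
          (mass_nonneg (rightMass_nonneg hμ (by norm_num)) f)).trans
          (energy_nonneg (rightCond_nonneg hK) f)
    · obtain ⟨r', hrr, hr'⟩ := EReal.exists_between_coe_real hr
      refine exists_splitting hμ (stateMeasure_pos ho ha hb) hK (stateCond_pos ho ha hb)
        (stateCond_pos' ho ha hb) ho hr0 (EReal.coe_lt_coe_iff.1 hrr)
        ((le_lam0_iff ho ha hb).1 hr'.le) ?_ ?_
      · by_cases h : M = ⊤
        · exact Or.inr (exists_lt_sum_Icc_of_not_summable_left ho ha hb (hM h))
        · exact Or.inl (exists_isLeast_stateSpace ho h)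
      · by_cases h : N = ⊤
        · exact Or.inr (exists_lt_sum_Icc_of_not_summable_right ho ha hb (hN h))
        · exact Or.inl (exists_isGreatest_stateSpace ho h)
  have hγ : 1 < t⁻¹ := (one_lt_inv₀ ht0).2 ht1
  refine le_trans (le_inf ?_ ?_) ((le_iSup₂ (f := fun γ (_ : γ ∈ Set.Ioi (1 : ℝ)) =>
    lamMinus M N a b θ γ ⊓ lamPlus M N a b θ γ) t⁻¹ hγ).trans
      (le_iSup₂ (f := fun θ (_ : θ ∈ stateSpace M N) => ⨆ γ ∈ Set.Ioi (1 : ℝ),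
        lamMinus M N a b θ γ ⊓ lamPlus M N a b θ γ) θ hθ))
  · exact (le_lamMinus_iff ho ha hb hθ hγ).2 (by rwa [inv_inv])
  · exact (le_lamPlus_iff ho ha hb hθ hγ).2 (by rwa [inv_inv])

end eigenvalues

end BirthDeath

theorem theorem7p10 (M N : WithTop ℤ) (a b : ℤ → ℝ) (o : ℤ)
    (ho : o ∈ BirthDeath.stateSpace M N)
    (ha : ∀ i ∈ BirthDeath.stateSpace M N, 0 < a i)
    (hb : ∀ i ∈ BirthDeath.stateSpace M N, 0 < b i) :
    ((⨅ θ ∈ BirthDeath.stateSpace M N, ⨅ γ ∈ Set.Ioi (1 : ℝ),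
        (BirthDeath.lamMinus M N a b θ γ ⊔ BirthDeath.lamPlus M N a b θ γ)) =
        BirthDeath.lam0 M N a b o ∧
      (⨆ θ : BirthDeath.SplitPoint M N, ⨆ γ ∈ Set.Ioi (1 : ℝ),
        (BirthDeath.lamMinusExt M N a b o γ θ ⊓ BirthDeath.lamPlusExt M N a b o γ θ)) ≤
        BirthDeath.lam0 M N a b o) ∧
    ((∃ θ ∈ BirthDeath.stateSpace M N, ∃ γ : ℝ, 1 < γ ∧ 0 < BirthDeath.lamMinus M N a b θ γ) →
      (∃ θ ∈ BirthDeath.stateSpace M N, ∃ γ : ℝ, 1 < γ ∧ 0 < BirthDeath.lamPlus M N a b θ γ) →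
      (M = ⊤ → ¬ Summable fun i : ↥(BirthDeath.stateSpace M N ∩ Set.Iic o) =>
        BirthDeath.symmMeasure a b o i) →
      (N = ⊤ → ¬ Summable fun i : ↥(BirthDeath.stateSpace M N ∩ Set.Ici o) =>
        BirthDeath.symmMeasure a b o i) →
      BirthDeath.lam0 M N a b o =
        ⨆ θ ∈ BirthDeath.stateSpace M N, ⨆ γ ∈ Set.Ioi (1 : ℝ),
          (BirthDeath.lamMinus M N a b θ γ ⊓ BirthDeath.lamPlus M N a b θ γ)) := by
  refine ⟨⟨le_antisymm (BirthDeath.iInf_sup_le_lam0 ho ha hb) ?_, ?_⟩, fun _ _ hM hN => ?_⟩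
  · exact le_iInf₂ fun θ hθ => le_iInf₂ fun γ hγ =>
      BirthDeath.lam0_le_lamMinus_sup_lamPlus ho ha hb hθ hγ
  · refine iSup_le fun θ => iSup₂_le fun γ hγ => ?_
    cases θ with
    | leftEnd => exact inf_le_right.trans (BirthDeath.lamReflectLeft_le_lam0 ho ha hb)
    | interior θ hθ => exact BirthDeath.lamMinus_inf_lamPlus_le_lam0 ho ha hb hθ hγ
    | rightEnd => exact inf_le_left.trans (BirthDeath.lamReflectRight_le_lam0 ho ha hb)
  · exact le_antisymm (BirthDeath.lam0_le_iSup_inf ho ha hb hM hN)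
      (iSup₂_le fun θ hθ => iSup₂_le fun γ hγ =>
        BirthDeath.lamMinus_inf_lamPlus_le_lam0 ho ha hb hθ hγ)
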